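/- Fix an integer $d\ge 0$ and let $Gr_d$ be the class of countable simple graphs (not necessarily connected) all of whose vertices have degree at most $d$. For $G\in Gr_d$ let $d_G$ be the graph distance ($\infty$ between different components) and $B_r(G,x)=\{y: d_G(x,y)\le r\}$. A graph $G$ of bounded degree is $D$-doubling if $|B_{2s}(G,x)|\le D\,|B_s(G,x)|$ for all $x\in V(G)$ and all integers $s\ge 1$. For $H\subseteq V(G)$ finite and non-empty, $\partial_G(H)$ is the set of vertices of $H$ that have a neighbour outside $H$, and $i_G(H)=|\partial_G(H)|/|H|$. A labeling $\varphi:V(G)\to M$ is $s$-separating if $\varphi(x)\ne\varphi(y)$ whenever $0<d_G(x,y)\le s$. Let $U_d^{n,s,M}$ be the set of rooted balls of radius $n$ with vertex degree bound $d$ equipped with an $s$-separating $M$-labeling, up to rooted labeled isomorphism. A map $\Theta:U_d^{n,s,M}\to Q$ (an oracle) and an $s$-separating $\varphi:V(G)\to M$ define the labeling $O_\Theta(\varphi):V(G)\to Q$ whose value at $x$ is $\Theta$ applied to the ball of radius $n$ around $x$ (the induced subgraph, rooted at $x$, labeled by the restriction of $\varphi$). Theorem. For every $D>1$, the class of $D$-doubling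 graphs in $Gr_d$ is distributed strongly almost finite. That is, for every $\varepsilon>0$ there exist integers $1\le s\le n$ and $N,K\ge 1$, finite sets $M,Q$ such that $|M|$ is at least the number of vertices of any rooted ball of radius $s$ and vertex degree bound $d$, and oracles $\Theta_1,\dots,\Theta_N:U_d^{n,s,M}\to Q$, such that for every $D$-doubling $G\in Gr_d$ and every $s$-separating $\varphi:V(G)\to M$, writing $H^i_x=\{z: d_G(x,z)\le K,\ O_{\Theta_i}(\varphi)(x)=O_{\Theta_i}(\varphi)(z)\}$: (1) for every $i$ and all $x,y\in V(G)$ with $O_{\Theta_i}(\varphi)(x)=O_{\Theta_i}(\varphi)(y)$, either $d_G(x,y)\le K$ or $d_G(x,y)\ge 3K$ (so the sets $H^i_x$ form a partition of $V(G)$); (2) $i_G(H^i_x)\le\varepsilon$ for every $i$ and every $x\in V(G)$; (3) for every $x\in V(G)$, $\ |\{i : x\in\partial_G(H^i_x)\}|/N\le\varepsilon$. -/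

import Mathlib

namespace QualitativeGraphs

/-- Every vertex of `G` has at most `d` neighbours. -/
def DegreeBound {V : Type} (G : SimpleGraph V) (d : ℕ) : Prop :=
  ∀ v, (G.neighborSet v).encard ≤ d

/-- The countable simple graphs of vertex degree bound `d` (not necessarily connected, finite or
infinite). -/
structure Gr (d : ℕ) where
  V : Type
  [countable : Countable V]
  graph : SimpleGraph V
  degreeBound : DegreeBound graph d

/-- The vertex set of the ball of radius `r` around `x`; `edist` is the graph distance, equal to
`⊤` for vertices in different components. -/
def ballSet {V : Type} (G : SimpleGraph V) (x : V) (r : ℕ) : Set V :=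
  {y | G.edist x y ≤ r}

/-- `φ` is `k`-separating: `φ x ≠ φ y` whenever `0 < d(x, y) ≤ k`. -/
def Separating {V Q : Type} (G : SimpleGraph V) (k : ℕ) (φ : V → Q) : Prop :=
  ∀ x y, 0 < G.edist x y → G.edist x y ≤ k → φ x ≠ φ y

/-- Rooted balls of radius `r` and vertex degree bound `d`. -/
structure RootedBall (d r : ℕ) where
  V : Type
  graph : SimpleGraph V
  root : V
  degreeBound : DegreeBound graph d
  radius : ∀ v, graph.edist root v ≤ r

/-- Rooted balls of radius `r` and vertex degree bound `d` with a `k`-separating `Q`-labeling. -/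
structure LabeledBall (d r k : ℕ) (Q : Type) extends RootedBall d r where
  label : V → Q
  separating : Separating graph k label

/-- Rooted labeled isomorphism. -/
def LabeledBall.Iso {d r k : ℕ} {Q : Type} (B C : LabeledBall d r k Q) : Prop :=
  ∃ e : B.graph ≃g C.graph, e B.root = C.root ∧ ∀ v, C.label (e v) = B.label v

instance LabeledBall.setoid (d r k : ℕ) (Q : Type) : Setoid (LabeledBall d r k Q) where
  r := LabeledBall.Iso
  iseqv :=
    { refl := fun _ => ⟨SimpleGraph.Iso.refl, rfl, fun _ => rfl⟩
      symm := by
        rintro B C ⟨e, h1, h2⟩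
        refine ⟨e.symm, ?_, fun v => ?_⟩
        · rw [← h1]; exact e.symm_apply_apply _
        · rw [← h2]; exact congrArg C.label (e.apply_symm_apply v)
      trans := by
        rintro A B C ⟨e, h1, h2⟩ ⟨f, h3, h4⟩
        refine ⟨e.trans f, ?_, fun v => ?_⟩
        · change f (e A.root) = C.root
          rw [h1, h3]
        · change C.label (f (e v)) = A.label v
          rw [h4, h2] }

/-- The set `U_d^{r,k,Q}` of `k`-separatingly `Q`-labeled rooted balls of radius `r` and vertex
degree bound `d`, up to rooted labeled isomorphism. -/
def U (d r k : ℕ) (Q : Type) : Type 1 := Quotient (LabeledBall.setoid d r k Q)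

theorem DegreeBound.induce {V : Type} {G : SimpleGraph V} {d : ℕ} (h : DegreeBound G d)
    (s : Set V) : DegreeBound (G.induce s) d := by
  intro v
  refine le_trans ?_ (h v)
  rw [← Subtype.val_injective.encard_image]
  apply Set.encard_le_encard
  rintro _ ⟨w, hw, rfl⟩
  exact hw

theorem edist_le_induce {V : Type} (G : SimpleGraph V) (s : Set V) (x y : s) :
    G.edist x y ≤ (G.induce s).edist x y := by
  by_cases h : (G.induce s).Reachable x y
  · obtain ⟨w, hw⟩ := h.exists_walk_length_eq_edist
    rw [← hw]
    have := SimpleGraph.edist_le (w.map (SimpleGraph.Embedding.induce s).toHom)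
    rwa [SimpleGraph.Walk.length_map] at this
  · rw [SimpleGraph.edist_eq_top_of_not_reachable h]
    exact le_top

theorem Separating.induce {V Q : Type} {G : SimpleGraph V} {k : ℕ} {φ : V → Q}
    (h : Separating G k φ) (s : Set V) :
    Separating (G.induce s) k (fun v : s => φ v) := by
  intro x y h1 h2
  refine h x y ?_ ((edist_le_induce G s x y).trans h2)
  rw [pos_iff_ne_zero, Ne, SimpleGraph.edist_eq_zero_iff] at h1 ⊢
  exact fun h3 => h1 (Subtype.ext h3)

theorem self_mem_ballSet {V : Type} (G : SimpleGraph V) (x : V) (r : ℕ) : x ∈ ballSet G x r := by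
  simp [ballSet]

theorem edist_induce_ballSet_le {V : Type} (G : SimpleGraph V) (x : V) (r : ℕ)
    (v : ballSet G x r) :
    (G.induce (ballSet G x r)).edist ⟨x, self_mem_ballSet G x r⟩ v ≤ r := by
  have hv : G.edist x v ≤ r := v.2
  have hr : G.Reachable x v := by
    by_contra h
    rw [SimpleGraph.edist_eq_top_of_not_reachable h] at hv
    simp at hv
  obtain ⟨w, hw⟩ := hr.exists_walk_length_eq_edist
  have hs : ∀ u ∈ w.support, u ∈ ballSet G x r := by
    classical
    intro u hu
    have h1 : G.edist x u ≤ (w.takeUntil u hu).length := SimpleGraph.edist_le _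
    have h2 : ((w.takeUntil u hu).length : ℕ∞) ≤ w.length := by
      exact_mod_cast w.length_takeUntil_le_length hu
    exact h1.trans (h2.trans (hw.le.trans hv))
  have h3 := SimpleGraph.edist_le (w.induce (ballSet G x r) hs)
  have h4 : (w.induce (ballSet G x r) hs).length = w.length := by
    conv_rhs => rw [← SimpleGraph.Walk.map_induce w hs]
    exact (SimpleGraph.Walk.length_map _ _).symm
  rw [h4] at h3
  exact h3.trans (hw.le.trans hv)

/-- The labeled rooted ball `B_r(G, x, φ)`: the subgraph of `G` induced on the ball of radius `r`
around `x`, rooted at `x` and labeled by the restriction of `φ`. -/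
def labeledBall {d : ℕ} (G : Gr d) (r : ℕ) {k : ℕ} {Q : Type} {φ : G.V → Q}
    (hφ : Separating G.graph k φ) (x : G.V) : LabeledBall d r k Q where
  V := ballSet G.graph x r
  graph := G.graph.induce (ballSet G.graph x r)
  root := ⟨x, self_mem_ballSet G.graph x r⟩
  degreeBound := G.degreeBound.induce _
  radius := edist_induce_ballSet_le G.graph x r
  label := fun v => φ v
  separating := hφ.induce _

/-- The operator `O_Θ` of the constant-time distributed algorithm with oracle `Θ`: it takes a
`k`-separating `Q₁`-labeling `φ` to the `Q₂`-labeling `x ↦ Θ(B_r(G, x, φ))`. -/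
def algorithm {d r k : ℕ} {Q₁ Q₂ : Type} (Θ : U d r k Q₁ → Q₂) (G : Gr d) {φ : G.V → Q₁}
    (hφ : Separating G.graph k φ) (x : G.V) : Q₂ :=
  Θ (Quotient.mk (LabeledBall.setoid d r k Q₁) (labeledBall G r hφ x))

/-- `M` is `(s, d)`-large: it has at least as many elements as any rooted ball of radius `s` and
vertex degree bound `d` has vertices. -/
def IsLarge (s d : ℕ) (M : Type) : Prop :=
  ∀ B : RootedBall d s, ENat.card B.V ≤ ENat.card M

/-- The (inner vertex) boundary: the vertices of `H` with a neighbour outside `H`. -/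
def boundary {V : Type} (G : SimpleGraph V) (H : Set V) : Set V :=
  {x | x ∈ H ∧ ∃ y, y ∉ H ∧ G.Adj x y}

/-- The isoperimetric constant `|∂H| / |H|` of a finite vertex set `H`. -/
noncomputable def isoperimetric {V : Type} (G : SimpleGraph V) (H : Set V) : ℝ :=
  ((boundary G H).ncard : ℝ) / (H.ncard : ℝ)

/-- The class `H_x` of `x` defined by the labeling `ψ` at scale `K`. -/
def partOf {V Q : Type} (G : SimpleGraph V) (K : ℕ) (ψ : V → Q) (x : V) : Set V :=
  {z | G.edist x z ≤ K ∧ ψ x = ψ z}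

/-- `Θ` is a distributed `(ε, K)`-partitioning oracle for the class `𝒢`. -/
def IsPartitioningOracle {d n s : ℕ} {M Q : Type} (𝒢 : Set (Gr d)) (ε : ℝ) (K : ℕ)
    (Θ : U d n s M → Q) : Prop :=
  ∀ G ∈ 𝒢, ∀ (φ : G.V → M) (hφ : Separating G.graph s φ),
    (∀ x y, algorithm Θ G hφ x = algorithm Θ G hφ y →
      G.graph.edist x y ≤ K ∨ 3 * (K : ℕ∞) ≤ G.graph.edist x y) ∧
    ∀ x, isoperimetric G.graph (partOf G.graph K (algorithm Θ G hφ) x) ≤ ε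

/-- The class `𝒢` is distributed strongly almost finite. -/
def DistributedStronglyAlmostFinite {d : ℕ} (𝒢 : Set (Gr d)) : Prop :=
  ∀ ε : ℝ, 0 < ε → ∃ s n N K : ℕ, 1 ≤ s ∧ s ≤ n ∧ 1 ≤ N ∧ 1 ≤ K ∧
    ∃ M Q : Type, Finite M ∧ Finite Q ∧ IsLarge s d M ∧
      ∃ Θ : Fin N → U d n s M → Q,
        (∀ i, IsPartitioningOracle 𝒢 ε K (Θ i)) ∧
        ∀ G ∈ 𝒢, ∀ (φ : G.V → M) (hφ : Separating G.graph s φ) (x : G.V),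
          ({i : Fin N | x ∈ boundary G.graph
              (partOf G.graph K (algorithm (Θ i) G hφ) x)}.ncard : ℝ) / (N : ℝ) ≤ ε

/-- A graph of bounded vertex degree is `D`-doubling if `|B_{2s}(x)| ≤ D |B_s(x)|` for all
vertices `x` and integers `s ≥ 1`. -/
def IsDoubling {V : Type} (D : ℝ) (G : SimpleGraph V) : Prop :=
  (∃ d : ℕ, DegreeBound G d) ∧ ∀ (x : V) (s : ℕ), 1 ≤ s →
    ((ballSet G x (2 * s)).ncard : ℝ) ≤ D * ((ballSet G x s).ncard : ℝ)

end QualitativeGraphs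

/-! The partition is a randomized Voronoi decomposition computed by a local greedy rule. Work at a
large scale `k`, with labels that separate up to distance `64 * k`. Processing the labels in
increasing order, a vertex becomes a center unless an earlier center lies within `4 * k`; each
center `p` also receives a shift `t < k`. A vertex joins the cell of the center minimizing distance
plus shift. Every cell contains the `k`-ball and lies in the `8 * k`-ball around its center, and by
doubling only `D ^ 6` centers lie in any ball of radius `16 * k`.

If `x` has a neighbour in another cell, the shifted distances from `x` to the two centers differ by
at most 2. Charge `x` to the center with the larger label. Given the earlier shifts, each earlier
nearby center allows at most 5 values of the new shift to put `x` in conflict, hence `5 * D ^ 6`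
values in all. Two consequences follow.

Averaging over `x` in the `8 * k`-ball of `p`, at least half of the shifts are good: their conflict
set is at most a fraction `1 / A` of that ball. Only good shifts are used, and doubling compares the
ball with the core of any nearby cell, so every cell has small boundary for every outcome
(`mul_ncard_boundary_le`).

A shift drawn uniformly from the good ones puts `x` in conflict with probability at most `10 * D ^ 6
/ k`. A union over the nearby centers, whose positions do not depend on the randomness, bounds the
probability that `x` is a boundary vertex (`ncard_boundary_seeds_le`).

Randomness is a seed in `Fin k.factorial` for each label, and there is one oracle for each seed
assignment. The rule is local because each label costs a bounded radius and there are finitely many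
labels (`algorithm_cellOracle`). -/

namespace QualitativeGraphs

/-! ### Balls, distances and volume bounds -/

section Balls

variable {V : Type} {G : SimpleGraph V}

theorem mem_ballSet_comm {x y : V} {r : ℕ} : y ∈ ballSet G x r ↔ x ∈ ballSet G y r := by
  simp only [ballSet, Set.mem_ofPred_eq, SimpleGraph.edist_comm]

theorem mem_ballSet_trans {x y z : V} {r t u : ℕ} (hy : y ∈ ballSet G x r)
    (hz : z ∈ ballSet G y t) (h : r + t ≤ u) : z ∈ ballSet G x u := by
  have h1 : G.edist x z ≤ G.edist x y + G.edist y z := SimpleGraph.edist_triangle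
  refine h1.trans ((add_le_add hy hz).trans ?_)
  exact_mod_cast h

theorem ballSet_mono {x : V} {r t : ℕ} (h : r ≤ t) : ballSet G x r ⊆ ballSet G x t :=
  fun _ hy => mem_ballSet_trans hy (self_mem_ballSet G _ 0) (by simpa using h)

/-- `dist` takes the value 0 between different components, so it may replace `edist` only where a
ball membership guarantees finite distance. -/
theorem coe_dist_of_mem_ballSet {x y : V} {r : ℕ} (h : y ∈ ballSet G x r) :
    (G.dist x y : ℕ∞) = G.edist x y :=
  ENat.natCast_toNat (ne_top_of_le_ne_top (ENat.natCast_ne_top r) h)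

theorem dist_le_of_mem_ballSet {x y : V} {r : ℕ} (h : y ∈ ballSet G x r) : G.dist x y ≤ r := by
  have h1 : G.edist x y ≤ r := h
  rw [← coe_dist_of_mem_ballSet h] at h1
  exact_mod_cast h1

theorem mem_ballSet_dist {x y : V} {r : ℕ} (h : y ∈ ballSet G x r) :
    y ∈ ballSet G x (G.dist x y) :=
  (coe_dist_of_mem_ballSet h).ge

theorem dist_triangle_of_mem_ballSet {x y z : V} {r t : ℕ} (hy : y ∈ ballSet G x r)
    (hz : z ∈ ballSet G y t) : G.dist x z ≤ G.dist x y + G.dist y z :=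
  dist_le_of_mem_ballSet
    (mem_ballSet_trans (mem_ballSet_dist hy) (mem_ballSet_dist hz) le_rfl)

theorem mem_ballSet_one_of_adj {x y : V} (h : G.Adj x y) : y ∈ ballSet G x 1 := by
  have := SimpleGraph.edist_le h.toWalk
  simpa [ballSet] using this

theorem encard_ballSet_le {d : ℕ} (hG : DegreeBound G d) (x : V) (r : ℕ) :
    (ballSet G x r).encard ≤ ((d + 1) ^ r : ℕ) := by
  induction r with
  | zero =>
    have : ballSet G x 0 = {x} := by
      ext y
      simp [ballSet, SimpleGraph.edist_eq_zero_iff, eq_comm (a := x)]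
    simp [this]
  | succ r ih =>
    have hfin : (ballSet G x r).Finite :=
      Set.finite_of_encard_le_coe ih
    have hsub : ballSet G x (r + 1) ⊆ ⋃ y ∈ hfin.toFinset, insert y (G.neighborSet y) := by
      intro z hz
      -- The walk runs from `z` to `x`, so that its first edge leads to a vertex within `r` of `x`.
      have hr : G.Reachable z x := by
        by_contra h
        have h1 : G.edist x z ≤ ((r + 1 : ℕ) : ℕ∞) := hz
        rw [SimpleGraph.edist_comm, SimpleGraph.edist_eq_top_of_not_reachable h] at h1
        exact absurd (top_le_iff.1 h1) (ENat.natCast_ne_top _)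
      obtain ⟨w, hw⟩ := hr.exists_walk_length_eq_edist
      have hl : w.length ≤ r + 1 := by
        have h1 : G.edist x z ≤ ((r + 1 : ℕ) : ℕ∞) := hz
        rw [SimpleGraph.edist_comm, ← hw] at h1
        exact_mod_cast h1
      simp only [Set.mem_iUnion, Set.Finite.mem_toFinset, Set.mem_insert_iff,
        SimpleGraph.mem_neighborSet]
      cases w with
      | nil => exact ⟨_, self_mem_ballSet _ _ _, Or.inl rfl⟩
      | @cons _ v _ h w =>
        refine ⟨v, ?_, Or.inr h.symm⟩
        rw [mem_ballSet_comm]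
        refine (SimpleGraph.edist_le w).trans ?_
        rw [SimpleGraph.Walk.length_cons] at hl
        exact_mod_cast Nat.le_of_succ_le_succ hl
    have hbd : ∀ s : Finset V,
        (⋃ y ∈ s, insert y (G.neighborSet y)).encard ≤ (s.card * (d + 1) : ℕ) := by
      classical
      intro s
      induction s using Finset.induction_on with
      | empty => simp
      | insert a s ha hs =>
        rw [Finset.set_biUnion_insert, Finset.card_insert_of_notMem ha]
        refine (Set.encard_union_le _ _).trans ?_
        have h1 : (insert a (G.neighborSet a)).encard ≤ d + 1 :=
          (Set.encard_insert_le _ _).trans (add_le_add_left (hG a) 1)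
        refine (add_le_add h1 hs).trans (le_of_eq ?_)
        push_cast
        ring
    refine (Set.encard_le_encard hsub).trans ((hbd _).trans ?_)
    rw [hfin.encard_eq_coe_toFinset_card] at ih
    have ih' : hfin.toFinset.card ≤ (d + 1) ^ r := by exact_mod_cast ih
    rw [pow_succ]
    exact_mod_cast Nat.mul_le_mul_right _ ih'

theorem finite_ballSet {d : ℕ} (hG : DegreeBound G d) (x : V) (r : ℕ) :
    (ballSet G x r).Finite :=
  Set.finite_of_encard_le_coe (encard_ballSet_le hG x r)

/-- A geodesic from `y` of length at most `r` stays within `d(x, y) + r ≤ n` of `x`, hence survives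
in the induced ball. -/
theorem edist_induce_eq {x : V} {n r : ℕ} {y z : ballSet G x n}
    (hy : G.edist x y + r ≤ n) (hz : G.edist y z ≤ r) :
    (G.induce (ballSet G x n)).edist y z = G.edist y z := by
  refine le_antisymm ?_ (edist_le_induce G _ y z)
  have hr : G.Reachable y z := by
    by_contra h
    rw [SimpleGraph.edist_eq_top_of_not_reachable h] at hz
    exact absurd (top_le_iff.1 hz) (ENat.natCast_ne_top _)
  obtain ⟨w, hw⟩ := hr.exists_walk_length_eq_edist
  have hs : ∀ u ∈ w.support, u ∈ ballSet G x n := by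
    classical
    intro u hu
    have h1 : G.edist y u ≤ (w.takeUntil u hu).length := SimpleGraph.edist_le _
    have h2 : ((w.takeUntil u hu).length : ℕ∞) ≤ w.length := by
      exact_mod_cast w.length_takeUntil_le_length hu
    have h3 : G.edist x u ≤ G.edist x y + G.edist y u := SimpleGraph.edist_triangle
    exact h3.trans ((add_le_add_right (h1.trans (h2.trans (hw.le.trans hz))) _).trans hy)
  have h3 := SimpleGraph.edist_le (w.induce (ballSet G x n) hs)
  have h4 : (w.induce (ballSet G x n) hs).length = w.length := by
    conv_rhs => rw [← SimpleGraph.Walk.map_induce w hs]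
    exact (SimpleGraph.Walk.length_map _ _).symm
  rw [h4, hw] at h3
  exact h3

end Balls

/-! ### Greedy centers, shifts and cells -/

section Construction

variable {V : Type} (G : SimpleGraph V) {m : ℕ} (k A : ℕ) (φ : V → Fin m)
  (ω : Fin m → Fin k.factorial)

/-- The vertices near `p` whose shifted distance to `p`, with shift `t`, nearly ties with the
shifted distance to one of the centers recorded in `τ`. -/
def conflict (τ : V → Option ℕ) (p : V) (t : ℕ) : Set V :=
  {x | x ∈ ballSet G p (8 * k) ∧ ∃ q u, τ q = some u ∧ q ∈ ballSet G x (8 * k) ∧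
    G.dist p x + t ≤ G.dist x q + u + 2 ∧ G.dist x q + u ≤ G.dist p x + t + 2}

/-- The shifts `t < k` of `p` for which the conflict set is a small part of the ball. -/
def goodShifts (τ : V → Option ℕ) (p : V) : Set ℕ :=
  {t | t < k ∧ A * (conflict G k τ p t).ncard ≤ (ballSet G p (8 * k)).ncard}

/-- The element of `S` selected by the seed `i`. -/
noncomputable def pick (i : ℕ) (S : Set ℕ) : ℕ := Nat.nth (· ∈ S) (i % S.ncard)

open Classical in
/-- Given the earlier centers and their shifts `τ`, decide whether `p` becomes a center, and with
which shift. -/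
noncomputable def centerStep (τ : V → Option ℕ) (p : V) (i : ℕ) : Option ℕ :=
  if ∃ q ∈ ballSet G p (4 * k), τ q ≠ none then none else some (pick i (goodShifts G k A τ p))

/-- The greedy choice, in the order of the labels, of centers together with their shifts; the value
is `none` off the set of centers. -/
noncomputable def shift (p : V) : Option ℕ :=
  centerStep G k A (fun q => if _h : φ q < φ p then shift q else none) p (ω (φ p))
termination_by (φ p).val
decreasing_by exact _h

/-- The restriction of `shift` to the vertices with smaller label than `p`. -/
noncomputable def earlierShift (p q : V) : Option ℕ :=
  if φ q < φ p then shift G k A φ ω q else none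

theorem shift_eq (p : V) :
    shift G k A φ ω p = centerStep G k A (earlierShift G k A φ ω p) p (ω (φ p)) := by
  rw [shift]
  rfl

/-- The cell of the center `q` contains `x`: among all centers near `x`, `q` minimizes the shifted
distance, ties being broken by the labels. -/
def Owns (σ : V → Option ℕ) (x q : V) : Prop :=
  q ∈ ballSet G x (8 * k) ∧ ∃ u, σ q = some u ∧ ∀ q' u', q' ∈ ballSet G x (8 * k) →
    σ q' = some u' → (G.dist x q + u) * m + φ q ≤ (G.dist x q' + u') * m + φ q'

/-- The set of labels of the centers whose cell contains `x`. -/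
def cellLabel (x : V) : Set (Fin m) :=
  {c | ∃ q, φ q = c ∧ Owns G k φ (shift G k A φ ω) x q}

end Construction

/-! ### The cell label depends only on a bounded labeled ball -/

section Locality

variable {V V' : Type} {G : SimpleGraph V} {G' : SimpleGraph V'} {m : ℕ} {k A : ℕ}
  {φ : V → Fin m} {φ' : V' → Fin m}

/-- `f` preserves labels and the balls of radius `r`, at all vertices of positive depth, where the
depth drops by at most one within such balls. -/
structure LocalMatch (G : SimpleGraph V) (G' : SimpleGraph V') (φ : V → Fin m) (φ' : V' → Fin m)
    (r : ℕ) (depth : ℕ → Set V) (f : V → V') : Prop where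
  inj : Function.Injective f
  label : ∀ v, φ' (f v) = φ v
  edist_eq : ∀ j, ∀ y ∈ depth (j + 1), ∀ z ∈ ballSet G y r, G'.edist (f y) (f z) = G.edist y z
  mem_depth : ∀ j, ∀ y ∈ depth (j + 1), ∀ z ∈ ballSet G y r, z ∈ depth j
  surj : ∀ j, ∀ y ∈ depth (j + 1), ∀ z' ∈ ballSet G' (f y) r, ∃ z ∈ ballSet G y r, f z = z'

namespace LocalMatch

variable {r : ℕ} {depth : ℕ → Set V} {f : V → V'}

theorem depth_antitone (h : LocalMatch G G' φ φ' r depth f) : Antitone depth :=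
  antitone_nat_of_succ_le fun j y hy => h.mem_depth j y hy y (self_mem_ballSet G y r)

theorem mem_iff (h : LocalMatch G G' φ φ' r depth f) {j t : ℕ} (ht : t ≤ r) {y z : V}
    (hy : y ∈ depth (j + 1)) : f z ∈ ballSet G' (f y) t ↔ z ∈ ballSet G y t := by
  constructor
  · intro hz
    obtain ⟨w, hw, hwz⟩ := h.surj j y hy _ (ballSet_mono ht hz)
    obtain rfl := h.inj hwz
    change G.edist y w ≤ t
    rw [← h.edist_eq j y hy w hw]
    exact hz
  · intro hz
    change G'.edist (f y) (f z) ≤ t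
    rw [h.edist_eq j y hy z (ballSet_mono ht hz)]
    exact hz

theorem dist_eq (h : LocalMatch G G' φ φ' r depth f) {j : ℕ} {y z : V}
    (hy : y ∈ depth (j + 1)) (hz : z ∈ ballSet G y r) : G'.dist (f y) (f z) = G.dist y z := by
  rw [SimpleGraph.dist, h.edist_eq j y hy z hz, SimpleGraph.dist]

theorem image_ballSet (h : LocalMatch G G' φ φ' r depth f) {j : ℕ} {y : V}
    (hy : y ∈ depth (j + 1)) : f '' ballSet G y r = ballSet G' (f y) r := by
  ext z'
  constructor
  · rintro ⟨z, hz, rfl⟩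
    exact (h.mem_iff le_rfl hy).2 hz
  · intro hz
    obtain ⟨z, hz', rfl⟩ := h.surj j y hy z' hz
    exact ⟨z, hz', rfl⟩

/-- Two levels of depth are consumed: one from `p` to `x`, one from `x` to the competing center `q`.
-/
theorem image_conflict (h : LocalMatch G G' φ φ' (8 * k) depth f) {j : ℕ} {p : V}
    (hp : p ∈ depth (j + 2)) {τ : V → Option ℕ} {τ' : V' → Option ℕ}
    (hτ : ∀ q ∈ depth j, τ' (f q) = τ q) (t : ℕ) :
    f '' conflict G k τ p t = conflict G' k τ' (f p) t := by
  have key : ∀ x, f x ∈ conflict G' k τ' (f p) t ↔ x ∈ conflict G k τ p t := by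
    intro x
    simp only [conflict, Set.mem_ofPred_eq, h.mem_iff le_rfl hp]
    refine and_congr_right fun hx => ?_
    have hx' := h.mem_depth _ _ hp _ hx
    rw [h.dist_eq hp hx]
    constructor
    · rintro ⟨q', u, hu, hq', h1⟩
      obtain ⟨q, hq, rfl⟩ := h.surj _ _ hx' _ hq'
      rw [hτ q (h.mem_depth _ _ hx' _ hq)] at hu
      rw [h.dist_eq hx' hq] at h1
      exact ⟨q, u, hu, hq, h1⟩
    · rintro ⟨q, u, hu, hq, h1⟩
      refine ⟨f q, u, ?_, (h.mem_iff le_rfl hx').2 hq, ?_⟩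
      · rw [hτ q (h.mem_depth _ _ hx' _ hq), hu]
      · rwa [h.dist_eq hx' hq]
  ext x'
  constructor
  · rintro ⟨x, hx, rfl⟩
    exact (key x).2 hx
  · intro hx
    obtain ⟨x, _, rfl⟩ := h.surj _ _ hp _ hx.1
    exact ⟨x, (key x).1 hx, rfl⟩

theorem centerStep_eq (h : LocalMatch G G' φ φ' (8 * k) depth f) {j : ℕ} {p : V}
    (hp : p ∈ depth (j + 2)) {τ : V → Option ℕ} {τ' : V' → Option ℕ}
    (hτ : ∀ q ∈ depth j, τ' (f q) = τ q) (i : ℕ) :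
    centerStep G' k A τ' (f p) i = centerStep G k A τ p i := by
  have h1 : goodShifts G' k A τ' (f p) = goodShifts G k A τ p := by
    simp only [goodShifts, ← h.image_conflict hp hτ, ← h.image_ballSet hp,
      Set.ncard_image_of_injective _ h.inj]
  have h48 : 4 * k ≤ 8 * k := by omega
  have hd : ∀ q ∈ ballSet G p (4 * k), q ∈ depth j := fun q hq =>
    h.depth_antitone (Nat.le_succ j) (h.mem_depth _ _ hp q (ballSet_mono h48 hq))
  have h2 : (∃ q ∈ ballSet G' (f p) (4 * k), τ' q ≠ none) ↔
      ∃ q ∈ ballSet G p (4 * k), τ q ≠ none := by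
    constructor
    · rintro ⟨q', hq', hn⟩
      obtain ⟨q, _, rfl⟩ := h.surj _ _ hp _ (ballSet_mono h48 hq')
      have hq := (h.mem_iff h48 hp).1 hq'
      exact ⟨q, hq, by rwa [hτ q (hd q hq)] at hn⟩
    · rintro ⟨q, hq, hn⟩
      exact ⟨f q, (h.mem_iff h48 hp).2 hq, by rwa [hτ q (hd q hq)]⟩
  simp only [centerStep, h1]
  split_ifs with ha hb hb
  · rfl
  · exact absurd (h2.1 ha) hb
  · exact absurd (h2.2 hb) ha
  · rfl

/-- Induction on the label: a decision consults only strictly smaller labels, and each costs two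
levels of depth. -/
theorem shift_eq (h : LocalMatch G G' φ φ' (8 * k) depth f) (ω : Fin m → Fin k.factorial) (p : V)
    (hp : p ∈ depth (2 * (φ p).val + 2)) : shift G' k A φ' ω (f p) = shift G k A φ ω p := by
  induction hc : (φ p).val using Nat.strong_induction_on generalizing p with
  | _ c ih =>
    subst hc
    rw [QualitativeGraphs.shift_eq, QualitativeGraphs.shift_eq, h.label]
    refine h.centerStep_eq hp (fun q hq => ?_) _
    simp only [earlierShift, h.label]
    split_ifs with hlt
    · have hlt' : (φ q).val < (φ p).val := hlt
      exact ih _ hlt' q (h.depth_antitone (by omega) hq) rfl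
    · rfl

/-- Centers near `x` have labels at most `m - 1`, so their shifts need depth at most `2 * m`; one
more level passes from `x` to them. -/
theorem cellLabel_eq (h : LocalMatch G G' φ φ' (8 * k) depth f) (ω : Fin m → Fin k.factorial) {x : V}
    (hx : x ∈ depth (2 * m + 1)) : cellLabel G' k A φ' ω (f x) = cellLabel G k A φ ω x := by
  have hσ : ∀ q ∈ ballSet G x (8 * k), shift G' k A φ' ω (f q) = shift G k A φ ω q := by
    intro q hq
    refine h.shift_eq ω q (h.depth_antitone ?_ (h.mem_depth _ _ hx q hq))
    have := (φ q).isLt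
    omega
  have key : ∀ q, Owns G' k φ' (shift G' k A φ' ω) (f x) (f q) ↔
      Owns G k φ (shift G k A φ ω) x q := by
    intro q
    simp only [Owns, h.mem_iff le_rfl hx]
    refine and_congr_right fun hq => ?_
    rw [hσ q hq, h.dist_eq hx hq, h.label]
    refine exists_congr fun u => and_congr_right fun _ => ?_
    constructor
    · intro H q' u' hq' hu'
      have := H (f q') u' ((h.mem_iff le_rfl hx).2 hq') (by rw [hσ q' hq', hu'])
      rwa [h.dist_eq hx hq', h.label] at this
    · intro H q' u' hq' hu'
      obtain ⟨z, hz, rfl⟩ := h.surj _ _ hx _ hq'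
      rw [h.dist_eq hx hz, h.label]
      exact H z u' hz (by rw [← hσ z hz, hu'])
  ext c
  constructor
  · rintro ⟨q', hc, hq'⟩
    obtain ⟨q, _, rfl⟩ := h.surj _ _ hx _ hq'.1
    exact ⟨q, by rwa [h.label] at hc, (key q).1 hq'⟩
  · rintro ⟨q, hc, hq⟩
    exact ⟨f q, by rwa [h.label], (key q).2 hq⟩

/-- This instance makes the oracle well defined on isomorphism classes. -/
theorem of_iso (e : G ≃g G') (he : ∀ v, φ' (e v) = φ v) :
    LocalMatch G G' φ φ' r (fun _ => Set.univ) e := by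
  have hd : ∀ y z, G'.edist (e y) (e z) = G.edist y z := by
    have hle : ∀ {W W' : Type} {H : SimpleGraph W} {H' : SimpleGraph W'} (e : H ≃g H') (y z),
        H'.edist (e y) (e z) ≤ H.edist y z := by
      intro W W' H H' e y z
      by_cases h : H.Reachable y z
      · obtain ⟨w, hw⟩ := h.exists_walk_length_eq_edist
        rw [← hw]
        have := SimpleGraph.edist_le (w.map e.toHom)
        rwa [SimpleGraph.Walk.length_map] at this
      · rw [SimpleGraph.edist_eq_top_of_not_reachable h]
        exact le_top
    intro y z
    refine le_antisymm (hle e y z) ?_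
    have h1 := hle e.symm (e y) (e z)
    rwa [e.symm_apply_apply, e.symm_apply_apply] at h1
  refine ⟨e.injective, he, fun _ _ _ _ _ => hd _ _, fun _ _ _ _ _ => trivial, ?_⟩
  intro _ y _ z' hz'
  refine ⟨e.symm z', ?_, e.apply_symm_apply z'⟩
  change G.edist y (e.symm z') ≤ r
  rw [← hd, e.apply_symm_apply]
  exact hz'

/-- This instance compares a ball with the whole graph: depth `j` means that `j` steps of length `r`
still fit inside the ball. -/
theorem of_ball (x : V) (n : ℕ) :
    LocalMatch (G.induce (ballSet G x n)) G (fun v => φ v) φ r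
      (fun j => {y | G.edist x y + (j * r : ℕ) ≤ n}) Subtype.val := by
  have hdr : ∀ {j : ℕ} {y : V}, G.edist x y + ((j + 1) * r : ℕ) ≤ n → G.edist x y + r ≤ n := by
    intro j y hy
    refine le_trans (add_le_add_right ?_ _) hy
    exact_mod_cast Nat.le_mul_of_pos_left r (Nat.succ_pos j)
  have hG : ∀ y z : ballSet G x n,
      z ∈ ballSet (G.induce (ballSet G x n)) y r → G.edist y z ≤ r :=
    fun y z hz => (edist_le_induce G _ y z).trans hz
  have hstep : ∀ {j : ℕ} {y z : V}, G.edist x y + ((j + 1) * r : ℕ) ≤ n → G.edist y z ≤ r →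
      G.edist x z + (j * r : ℕ) ≤ n := by
    intro j y z hy hz
    have h1 : G.edist x z ≤ G.edist x y + G.edist y z := SimpleGraph.edist_triangle
    refine le_trans (add_le_add_left (h1.trans (add_le_add_right hz _)) _) (le_trans ?_ hy)
    rw [add_assoc]
    refine add_le_add_right ?_ _
    push_cast
    rw [add_mul, one_mul, add_comm]
  refine ⟨Subtype.val_injective, fun _ => rfl, ?_, ?_, ?_⟩
  · intro j y hy z hz
    exact (edist_induce_eq (hdr hy) (hG y z hz)).symm
  · intro j y hy z hz
    exact hstep hy (hG y z hz)
  · intro j y hy z' hz'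
    have hz : z' ∈ ballSet G x n := by
      refine le_trans ?_ (hstep hy hz')
      exact le_self_add
    refine ⟨⟨z', hz⟩, ?_, rfl⟩
    change (G.induce (ballSet G x n)).edist y ⟨z', hz⟩ ≤ r
    have hle : G.edist y z' ≤ r := hz'
    rwa [edist_induce_eq (z := ⟨z', hz⟩) (hdr hy) hle]

end LocalMatch

/-- The oracle computing `cellLabel` at the root of a labeled ball. -/
noncomputable def cellOracle (d n s m k A : ℕ) (ω : Fin m → Fin k.factorial) :
    U d n s (Fin m) → Set (Fin m) :=
  Quotient.lift (fun B : LabeledBall d n s (Fin m) => cellLabel B.graph k A B.label ω B.root) (by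
    rintro B C ⟨e, h1, h2⟩
    rw [← h1, (LocalMatch.of_iso (r := 8 * k) e h2).cellLabel_eq ω trivial])

theorem algorithm_cellOracle {d n s m k A : ℕ} (ω : Fin m → Fin k.factorial) (G : Gr d)
    {φ : G.V → Fin m} (hφ : Separating G.graph s φ) (hn : (2 * m + 1) * (8 * k) ≤ n) (x : G.V) :
    algorithm (cellOracle d n s m k A ω) G hφ x = cellLabel G.graph k A φ ω x := by
  have h := LocalMatch.of_ball (G := G.graph) (φ := φ) (r := 8 * k) x n
  refine (h.cellLabel_eq (A := A) ω (x := ⟨x, self_mem_ballSet G.graph x n⟩) ?_).symm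
  change G.graph.edist x x + _ ≤ _
  rw [SimpleGraph.edist_self, zero_add]
  exact_mod_cast hn

end Locality

/-! ### Uniform selection and averaging over seeds -/

section Seeds

theorem pick_mem {S : Set ℕ} (hS : S.Finite) (hpos : 0 < S.ncard) (i : ℕ) : pick i S ∈ S := by
  refine Nat.nth_mem_of_lt_card (p := (· ∈ S)) hS ?_
  have h := Nat.mod_lt i hpos
  rwa [Set.ncard_eq_toFinset_card S hS] at h ⊢

theorem mod_eq_of_pick_eq {S : Set ℕ} (hS : S.Finite) (hpos : 0 < S.ncard) {i j : ℕ}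
    (h : pick i S = pick j S) : i % S.ncard = j % S.ncard := by
  refine Nat.nth_injOn (p := (· ∈ S)) hS ?_ ?_ h
  · have h := Nat.mod_lt i hpos
    rw [Set.mem_Iio]
    rwa [Set.ncard_eq_toFinset_card S hS] at h ⊢
  · have h := Nat.mod_lt j hpos
    rw [Set.mem_Iio]
    rwa [Set.ncard_eq_toFinset_card S hS] at h ⊢

/-- A uniform seed selects an element of `B` with probability at most `|B| / |S|`. -/
theorem card_pick_mem_le {S B : Set ℕ} (hS : S.Finite) (hB : B.Finite) {k : ℕ}
    (hpos : 0 < S.ncard) (hSk : S.ncard ≤ k) :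
    {i : Fin k.factorial | pick i S ∈ B}.ncard * S.ncard ≤ B.ncard * k.factorial := by
  -- Since `S.ncard` divides `k.factorial`, reduction modulo `S.ncard` is exactly uniform: each
  -- element is picked by `e` seeds, told apart by their quotients.
  obtain ⟨e, he⟩ := Nat.dvd_factorial hpos hSk
  have h1 : {i : Fin k.factorial | pick i S ∈ B}.ncard ≤
      ((hB.toFinset ×ˢ Finset.range e : Finset (ℕ × ℕ)) : Set (ℕ × ℕ)).ncard := by
    refine Set.ncard_le_ncard_of_injOn (fun i => (pick i S, i.val / S.ncard)) ?_ ?_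
      (Finset.finite_toSet _)
    · intro i hi
      simp only [Finset.coe_product, Set.Finite.coe_toFinset, Finset.coe_range, Set.mem_prod,
        Set.mem_Iio]
      exact ⟨hi, Nat.div_lt_of_lt_mul (he ▸ i.isLt)⟩
    · intro i _ j _ hij
      simp only [Prod.mk.injEq] at hij
      have hm := mod_eq_of_pick_eq hS hpos hij.1
      apply Fin.ext
      rw [← Nat.div_add_mod i.val S.ncard, ← Nat.div_add_mod j.val S.ncard, hij.2, hm]
  rw [Set.ncard_coe_finset, Finset.card_product, Finset.card_range,
    ← Set.ncard_eq_toFinset_card B hB] at h1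
  calc _ ≤ B.ncard * e * S.ncard := Nat.mul_le_mul_right _ h1
    _ = B.ncard * k.factorial := by rw [he]; ring

/-- If each fibre in one coordinate has proportion at most `b / a`, so has the whole set. -/
theorem card_le_of_update {ι S : Type} [Fintype ι] [DecidableEq ι] [Fintype S]
    (P : (ι → S) → Prop) (c : ι) (a b : ℕ) (hS : 0 < Fintype.card S)
    (h : ∀ ω : ι → S, {i | P (Function.update ω c i)}.ncard * a ≤ b * Fintype.card S) :
    {ω | P ω}.ncard * a ≤ b * Fintype.card (ι → S) := by
  classical
  have hcard : {ω | P ω}.ncard * Fintype.card S =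
      ∑ ω : ι → S, {i | P (Function.update ω c i)}.ncard := by
    have h1 : {ω | P ω}.ncard * Fintype.card S =
        (Finset.univ.filter fun x : (ι → S) × S => P x.1).card := by
      rw [← Finset.univ_product_univ,
        show (Finset.univ ×ˢ Finset.univ : Finset ((ι → S) × S)).filter (fun x => P x.1) =
          (Finset.univ.filter P) ×ˢ Finset.univ by ext; simp, Finset.card_product,
        Finset.card_univ, ← Set.ncard_coe_finset]
      simp
    -- Exchanging coordinate `c` of `ω` with the extra sample is an involution.
    have h2 : (Finset.univ.filter fun x : (ι → S) × S => P x.1).card =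
        (Finset.univ.filter fun x : (ι → S) × S => P (Function.update x.1 c x.2)).card := by
      have hinv : ∀ x : (ι → S) × S,
          Function.update (Function.update x.1 c x.2) c (x.1 c) = x.1 := by
        intro x
        simp
      refine Finset.card_bij' (fun x _ => (Function.update x.1 c x.2, x.1 c))
        (fun x _ => (Function.update x.1 c x.2, x.1 c)) ?_ ?_ ?_ ?_
      · intro x hx
        simp only [Finset.mem_filter, Finset.mem_univ, true_and] at hx ⊢
        rwa [hinv]
      · intro x hx
        simp only [Finset.mem_filter, Finset.mem_univ, true_and] at hx ⊢
        exact hx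
      · intro x _
        exact Prod.ext (hinv x) (by simp)
      · intro x _
        exact Prod.ext (hinv x) (by simp)
    rw [h1, h2, Finset.card_filter, Fintype.sum_prod_type]
    refine Finset.sum_congr rfl fun ω _ => ?_
    rw [← Finset.card_filter, ← Set.ncard_coe_finset]
    simp
  refine Nat.le_of_mul_le_mul_left ?_ hS
  calc Fintype.card S * ({ω | P ω}.ncard * a)
      = ({ω | P ω}.ncard * Fintype.card S) * a := by ring
    _ = ∑ ω : ι → S, {i | P (Function.update ω c i)}.ncard * a := by
        rw [hcard, Finset.sum_mul]
    _ ≤ ∑ _ω : ι → S, b * Fintype.card S := Finset.sum_le_sum fun ω _ => h ω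
    _ = Fintype.card S * (b * Fintype.card (ι → S)) := by
        rw [Finset.sum_const, Finset.card_univ, smul_eq_mul]; ring

end Seeds

/-! ### Packing of separated sets under doubling -/

section Packing

variable {V : Type} {G : SimpleGraph V} {d D k : ℕ}

theorem ncard_ballSet_le_pow
    (hD : ∀ (x : V) (s : ℕ), 1 ≤ s → (ballSet G x (2 * s)).ncard ≤ D * (ballSet G x s).ncard)
    (hk : 1 ≤ k) (x : V) (j : ℕ) :
    (ballSet G x (2 ^ j * k)).ncard ≤ D ^ j * (ballSet G x k).ncard := by
  induction j with
  | zero => simp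
  | succ j ih =>
    have h := hD x (2 ^ j * k) (Nat.mul_pos (by positivity) hk)
    rw [pow_succ', pow_succ', mul_assoc, mul_assoc]
    exact h.trans (Nat.mul_le_mul_left _ ih)

theorem ncard_ballSet_pos (hG : DegreeBound G d) (x : V) (r : ℕ) : 0 < (ballSet G x r).ncard :=
  (Set.ncard_pos (finite_ballSet hG x r)).2 ⟨x, self_mem_ballSet G x r⟩

/-- In a doubling graph, a `4 * k`-separated set has boundedly many points in a ball of radius
`16 * k`. -/
theorem ncard_inter_ballSet_le (hG : DegreeBound G d)
    (hD : ∀ (x : V) (s : ℕ), 1 ≤ s → (ballSet G x (2 * s)).ncard ≤ D * (ballSet G x s).ncard)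
    (hk : 1 ≤ k) {S : Set V} (hS : ∀ p ∈ S, ∀ q ∈ S, q ∈ ballSet G p (4 * k) → p = q) (x : V) :
    (S ∩ ballSet G x (16 * k)).ncard ≤ D ^ 6 := by
  classical
  have hfin : (S ∩ ballSet G x (16 * k)).Finite := (finite_ballSet hG x _).inter_of_right _
  have hb := fun (y : V) r => Set.ncard_eq_toFinset_card _ (finite_ballSet hG y r)
  have hdisj : (hfin.toFinset : Set V).PairwiseDisjoint
      fun q => (finite_ballSet hG q k).toFinset := by
    intro p hp q hq hpq
    rw [Set.Finite.coe_toFinset] at hp hq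
    refine Finset.disjoint_left.2 fun z hz hz' => hpq (hS p hp.1 q hq.1 ?_)
    rw [Set.Finite.mem_toFinset] at hz hz'
    exact mem_ballSet_trans hz (mem_ballSet_comm.1 hz') (by omega)
  have hsum : ∑ q ∈ hfin.toFinset, (ballSet G q k).ncard ≤ (ballSet G x (17 * k)).ncard := by
    simp only [hb]
    rw [← Finset.card_biUnion hdisj]
    refine Finset.card_le_card fun z hz => ?_
    simp only [Finset.mem_biUnion, Set.Finite.mem_toFinset] at hz ⊢
    obtain ⟨q, hq, hz⟩ := hz
    exact mem_ballSet_trans hq.2 hz (by omega)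
  -- The ball of radius `17 * k` at `x` lies in that of radius `33 * k ≤ 2 ^ 6 * k` at `q`. So each
  -- of the disjoint `k`-balls occupies at least a fraction `1 / D ^ 6` of it.
  have hcmp : ∀ q ∈ hfin.toFinset,
      (ballSet G x (17 * k)).ncard ≤ D ^ 6 * (ballSet G q k).ncard := by
    intro q hq
    rw [Set.Finite.mem_toFinset] at hq
    refine le_trans (Set.ncard_le_ncard ?_ (finite_ballSet hG q (2 ^ 6 * k)))
      (ncard_ballSet_le_pow hD hk q 6)
    intro z hz
    exact mem_ballSet_trans (mem_ballSet_comm.1 hq.2) hz (by omega)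
  have h1 := Finset.card_nsmul_le_sum _ _ _ hcmp
  rw [← Finset.mul_sum, smul_eq_mul, ← Set.ncard_eq_toFinset_card _ hfin] at h1
  exact Nat.le_of_mul_le_mul_right (h1.trans (Nat.mul_le_mul_left _ hsum))
    (ncard_ballSet_pos hG x _)

end Packing

/-! ### Most shifts are good -/

section Shifts

variable {V : Type} {G : SimpleGraph V} {d C k A : ℕ}

/-- A given vertex is in conflict for boundedly many shifts. -/
theorem ncard_conflict_shifts_le (hG : DegreeBound G d) {τ : V → Option ℕ} (p x : V)
    (hτ : ({q | τ q ≠ none} ∩ ballSet G x (8 * k)).ncard ≤ C) :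
    {t | x ∈ conflict G k τ p t}.Finite ∧ {t | x ∈ conflict G k τ p t}.ncard ≤ 5 * C := by
  classical
  have hfin : ({q | τ q ≠ none} ∩ ballSet G x (8 * k)).Finite :=
    (finite_ballSet hG x _).inter_of_right _
  -- For fixed `q`, a near tie within 2 confines `t` to an interval of at most 5 integers.
  let I : V → Finset ℕ := fun q =>
    Finset.Icc (G.dist x q + (τ q).getD 0 - 2 - G.dist p x)
      (G.dist x q + (τ q).getD 0 + 2 - G.dist p x)
  have hsub : {t | x ∈ conflict G k τ p t} ⊆ (hfin.toFinset.biUnion I : Finset ℕ) := by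
    rintro t ⟨_, q, u, hu, hq, h1, h2⟩
    simp only [Finset.coe_biUnion, Set.mem_iUnion, Set.Finite.coe_toFinset]
    refine ⟨q, ⟨by simp [hu], hq⟩, ?_⟩
    simp only [I, hu, Option.getD_some, Finset.coe_Icc, Set.mem_Icc]
    omega
  refine ⟨(Finset.finite_toSet _).subset hsub, ?_⟩
  refine (Set.ncard_le_ncard hsub (Finset.finite_toSet _)).trans ?_
  rw [Set.ncard_coe_finset]
  refine (Finset.card_biUnion_le_card_mul _ _ 5 fun q _ => ?_).trans ?_
  · rw [Nat.card_Icc]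
    omega
  · rw [← Set.ncard_eq_toFinset_card _ hfin, mul_comm]
    exact Nat.mul_le_mul_left _ hτ

theorem goodShifts_finite (τ : V → Option ℕ) (p : V) : (goodShifts G k A τ p).Finite :=
  (Set.finite_Iio k).subset fun _ ht => ht.1

theorem ncard_goodShifts_le (τ : V → Option ℕ) (p : V) : (goodShifts G k A τ p).ncard ≤ k := by
  have hsub : goodShifts G k A τ p ⊆ (Finset.range k : Finset ℕ) :=
    fun t ht => Finset.mem_coe.2 (Finset.mem_range.2 ht.1)
  have := Set.ncard_le_ncard hsub (Finset.finite_toSet _)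
  rwa [Set.ncard_coe_finset, Finset.card_range] at this

/-- At least half of the shifts are good. -/
theorem le_two_mul_ncard_goodShifts (hG : DegreeBound G d) {τ : V → Option ℕ} (p : V)
    (hτ : ∀ x, ({q | τ q ≠ none} ∩ ballSet G x (8 * k)).ncard ≤ C) (hk : 10 * C * A ≤ k) :
    k ≤ 2 * (goodShifts G k A τ p).ncard := by
  classical
  set b := (ballSet G p (8 * k)).ncard with hb
  have hbpos : 0 < b := ncard_ballSet_pos hG p _
  have hBfin := finite_ballSet hG p (8 * k)
  let bad := (Finset.range k).filter fun t => t ∉ goodShifts G k A τ p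
  have hgood : (goodShifts G k A τ p).ncard =
      ((Finset.range k).filter fun t => t ∈ goodShifts G k A τ p).card := by
    rw [← Set.ncard_coe_finset]
    congr 1
    ext t
    simp only [Finset.coe_filter, Finset.mem_range, Set.mem_ofPred_eq]
    exact ⟨fun h => ⟨h.1, h⟩, fun h => h.2⟩
  have hsplit : (goodShifts G k A τ p).ncard + bad.card = k := by
    rw [hgood, Finset.card_filter_add_card_filter_not, Finset.card_range]
  -- Double counting of the pairs of a shift and a vertex in conflict.
  have hdc : ∑ t ∈ Finset.range k, (conflict G k τ p t).ncard ≤ b * (5 * C) := by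
    have h1 : ∀ t, (conflict G k τ p t).ncard =
        (Finset.bipartiteAbove (fun t x => x ∈ conflict G k τ p t) hBfin.toFinset t).card := by
      intro t
      rw [← Set.ncard_coe_finset]
      congr 1
      ext x
      simp only [Finset.coe_bipartiteAbove, Set.mem_ofPred_eq, Set.Finite.mem_toFinset]
      exact ⟨fun h => ⟨h.1, h⟩, fun h => h.2⟩
    simp only [h1]
    rw [Finset.sum_card_bipartiteAbove_eq_sum_card_bipartiteBelow, hb,
      Set.ncard_eq_toFinset_card (ballSet G p (8 * k)) hBfin]
    refine Finset.sum_le_card_nsmul hBfin.toFinset _ (5 * C) fun x _ => ?_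
    obtain ⟨hf, hle⟩ := ncard_conflict_shifts_le (C := C) hG p x (hτ x)
    refine le_trans ?_ hle
    rw [← Set.ncard_coe_finset]
    refine Set.ncard_le_ncard (fun t ht => ?_) hf
    simp only [Finset.coe_bipartiteBelow, Set.mem_ofPred_eq] at ht
    exact ht.2
  have hbad : bad.card * b ≤ A * ∑ t ∈ Finset.range k, (conflict G k τ p t).ncard := by
    rw [Finset.mul_sum, ← smul_eq_mul]
    refine le_trans (Finset.card_nsmul_le_sum bad (fun t => A * (conflict G k τ p t).ncard) b ?_)
      (Finset.sum_le_sum_of_subset (Finset.filter_subset _ _))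
    intro t ht
    simp only [bad, Finset.mem_filter, Finset.mem_range, goodShifts, Set.mem_ofPred_eq,
      not_and, not_le] at ht
    exact (ht.2 ht.1).le
  -- Each bad shift has more than `b / A` conflicts, out of a total of at most `5 * C * b`.
  have hbad' : bad.card ≤ 5 * C * A := by
    refine Nat.le_of_mul_le_mul_right (hbad.trans ?_) hbpos
    calc _ ≤ A * (b * (5 * C)) := Nat.mul_le_mul_left _ hdc
      _ = 5 * C * A * b := by ring
  have : 10 * C * A = 2 * (5 * C * A) := by ring
  omega

end Shifts

/-- A doubling graph with a separating labeling, and parameters compatible with them. -/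
structure CellSetting {V : Type} (G : SimpleGraph V) (d D k A : ℕ) {m : ℕ} (φ : V → Fin m) :
    Prop where
  deg : DegreeBound G d
  doubling : ∀ (x : V) (s : ℕ), 1 ≤ s → (ballSet G x (2 * s)).ncard ≤ D * (ballSet G x s).ncard
  sep : Separating G (64 * k) φ
  D_pos : 1 ≤ D
  A_pos : 1 ≤ A
  le_k : 10 * D ^ 6 * A ≤ k

/-! ### Dependence of centers and shifts on the seeds -/

section Centers

variable {V : Type} {G : SimpleGraph V} {k A m : ℕ} {φ : V → Fin m}

theorem earlierShift_eq_some {ω : Fin m → Fin k.factorial} {p q : V} {u : ℕ} :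
    earlierShift G k A φ ω p q = some u ↔ φ q < φ p ∧ shift G k A φ ω q = some u := by
  unfold earlierShift
  split_ifs with h <;> simp [h]

theorem earlierShift_ne_none {ω : Fin m → Fin k.factorial} {p q : V} :
    earlierShift G k A φ ω p q ≠ none ↔ φ q < φ p ∧ shift G k A φ ω q ≠ none := by
  unfold earlierShift
  split_ifs with h <;> simp [h]

theorem shift_eq_none_iff {ω : Fin m → Fin k.factorial} {p : V} :
    shift G k A φ ω p = none ↔
      ∃ q ∈ ballSet G p (4 * k), φ q < φ p ∧ shift G k A φ ω q ≠ none := by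
  have hiff := exists_congr fun q => and_congr_right (a := q ∈ ballSet G p (4 * k)) fun _ =>
    earlierShift_ne_none (G := G) (A := A) (φ := φ) (ω := ω) (p := p) (q := q)
  rw [shift_eq, centerStep, ← hiff]
  split_ifs with h
  · exact ⟨fun _ => h, fun _ => rfl⟩
  · exact ⟨False.elim, fun h' => absurd h' h⟩

theorem shift_eq_some {ω : Fin m → Fin k.factorial} {p : V} {u : ℕ}
    (h : shift G k A φ ω p = some u) :
    u = pick (ω (φ p)) (goodShifts G k A (earlierShift G k A φ ω p) p) := by
  rw [shift_eq, centerStep] at h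
  split_ifs at h
  exact (Option.some.inj h).symm

/-- The set of centers does not depend on the seeds. -/
theorem shift_eq_none_congr (ω ω' : Fin m → Fin k.factorial) (p : V) :
    shift G k A φ ω p = none ↔ shift G k A φ ω' p = none := by
  induction hc : (φ p).val using Nat.strong_induction_on generalizing p with
  | _ c ih =>
    subst hc
    rw [shift_eq_none_iff, shift_eq_none_iff]
    refine exists_congr fun q => and_congr_right fun _ => and_congr_right fun hq => ?_
    exact not_congr (ih _ hq q rfl)

/-- The shift of `p` depends only on the seeds of labels up to that of `p`. -/
theorem shift_congr {ω ω' : Fin m → Fin k.factorial} (p : V) (h : ∀ c ≤ φ p, ω c = ω' c) :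
    shift G k A φ ω p = shift G k A φ ω' p := by
  induction hc : (φ p).val using Nat.strong_induction_on generalizing p with
  | _ c ih =>
    subst hc
    rw [shift_eq, shift_eq, h _ le_rfl]
    congr 1
    funext q
    unfold earlierShift
    split_ifs with hq
    · exact ih _ hq q (fun c hc => h c (hc.trans hq.le)) rfl
    · rfl

/-- This is the independence behind the probability estimate: resampling the seed of `φ p` leaves
the data defining the good shifts of `p` unchanged. -/
theorem earlierShift_update (ω : Fin m → Fin k.factorial) (p : V) (i : Fin k.factorial) :
    earlierShift G k A φ (Function.update ω (φ p) i) p = earlierShift G k A φ ω p := by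
  funext q
  unfold earlierShift
  split_ifs with hq
  · exact shift_congr q fun c hc => Function.update_of_ne (hc.trans_lt hq).ne _ _
  · rfl

theorem exists_center (ω : Fin m → Fin k.factorial) (x : V) :
    ∃ q ∈ ballSet G x (4 * k), shift G k A φ ω q ≠ none := by
  by_cases h : shift G k A φ ω x = none
  · obtain ⟨q, hq, _, hn⟩ := shift_eq_none_iff.1 h
    exact ⟨q, hq, hn⟩
  · exact ⟨x, self_mem_ballSet G x _, h⟩

end Centers

/-! ### Geometry of the cells and boundary estimates -/

namespace CellSetting

variable {V : Type} {G : SimpleGraph V} {d D k A m : ℕ} {φ : V → Fin m}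

theorem k_pos (h : CellSetting G d D k A φ) : 1 ≤ k := by
  refine le_trans ?_ h.le_k
  have := Nat.mul_pos (Nat.mul_pos (by norm_num : 0 < 10) (pow_pos h.D_pos 6)) h.A_pos
  exact this

theorem eq_of_label_eq (h : CellSetting G d D k A φ) {p q : V} {r : ℕ} (hr : r ≤ 64 * k)
    (hpq : q ∈ ballSet G p r) (hφ : φ p = φ q) : p = q := by
  by_contra hne
  refine h.sep p q ?_ (ballSet_mono hr hpq) hφ
  rw [pos_iff_ne_zero, Ne, SimpleGraph.edist_eq_zero_iff]
  exact hne

/-- The center with the larger label would have been rejected; equal labels do not occur at this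
range. -/
theorem center_separated (h : CellSetting G d D k A φ) (ω : Fin m → Fin k.factorial) (p : V)
    (hp : shift G k A φ ω p ≠ none) (q : V) (hq : shift G k A φ ω q ≠ none)
    (hpq : q ∈ ballSet G p (4 * k)) : p = q := by
  rcases lt_trichotomy (φ p) (φ q) with hlt | heq | hlt
  · exact absurd (shift_eq_none_iff.2 ⟨p, mem_ballSet_comm.1 hpq, hlt, hp⟩) hq
  · exact h.eq_of_label_eq (by omega) hpq heq
  · exact absurd (shift_eq_none_iff.2 ⟨q, hpq, hlt, hq⟩) hp

theorem ncard_centers_le (h : CellSetting G d D k A φ) (ω : Fin m → Fin k.factorial) (x : V) :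
    ({q | shift G k A φ ω q ≠ none} ∩ ballSet G x (16 * k)).ncard ≤ D ^ 6 :=
  ncard_inter_ballSet_le h.deg h.doubling h.k_pos (h.center_separated ω) x

theorem ncard_earlier_le (h : CellSetting G d D k A φ) (ω : Fin m → Fin k.factorial) (p x : V) :
    ({q | earlierShift G k A φ ω p q ≠ none} ∩ ballSet G x (8 * k)).ncard ≤ D ^ 6 := by
  refine le_trans (Set.ncard_le_ncard (Set.inter_subset_inter ?_ (ballSet_mono (by omega)))
    ((finite_ballSet h.deg x _).inter_of_right _)) (h.ncard_centers_le ω x)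
  exact fun q hq => (earlierShift_ne_none.1 hq).2

theorem le_ncard_goodShifts (h : CellSetting G d D k A φ) (ω : Fin m → Fin k.factorial) (p : V) :
    k ≤ 2 * (goodShifts G k A (earlierShift G k A φ ω p) p).ncard :=
  le_two_mul_ncard_goodShifts h.deg p (h.ncard_earlier_le ω p) h.le_k

theorem shift_mem_goodShifts (h : CellSetting G d D k A φ) {ω : Fin m → Fin k.factorial} {p : V}
    {u : ℕ} (hu : shift G k A φ ω p = some u) :
    u ∈ goodShifts G k A (earlierShift G k A φ ω p) p := by
  rw [shift_eq_some hu]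
  refine pick_mem (goodShifts_finite _ _) ?_ _
  have := h.le_ncard_goodShifts ω p
  have := h.k_pos
  omega

theorem exists_owns (ω : Fin m → Fin k.factorial) (x : V) :
    ∃ p, Owns G k φ (shift G k A φ ω) x p := by
  obtain ⟨q, hq, hn⟩ := exists_center (G := G) (A := A) (φ := φ) ω x
  let key : V → ℕ := fun q => (G.dist x q + (shift G k A φ ω q).getD 0) * m + φ q
  let S : Set V := {q | q ∈ ballSet G x (8 * k) ∧ shift G k A φ ω q ≠ none}
  obtain ⟨p, hp, hmin⟩ := (measure key).wf.has_min S
    ⟨q, ballSet_mono (by omega) hq, hn⟩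
  obtain ⟨u, hu⟩ := Option.ne_none_iff_exists'.1 hp.2
  refine ⟨p, hp.1, u, hu, fun q' u' hq' hu' => ?_⟩
  have hle : ¬ key q' < key p := hmin q' ⟨hq', by simp [hu']⟩
  simpa only [key, hu, hu', Option.getD_some, not_lt] using hle

/-- The key being minimized has residue `φ p` modulo `m`, so equal minima have equal labels, and
both centers are within `16 * k` of each other. -/
theorem owns_unique (h : CellSetting G d D k A φ) {ω : Fin m → Fin k.factorial} {x p q : V}
    (hp : Owns G k φ (shift G k A φ ω) x p) (hq : Owns G k φ (shift G k A φ ω) x q) : p = q := by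
  obtain ⟨hp, u, hu, hpmin⟩ := hp
  obtain ⟨hq, v, hv, hqmin⟩ := hq
  have heq := le_antisymm (hpmin q v hq hv) (hqmin p u hp hu)
  have hmod := congrArg (· % m) heq
  simp only [Nat.mul_add_mod_self_right, Nat.mod_eq_of_lt (φ p).isLt,
    Nat.mod_eq_of_lt (φ q).isLt] at hmod
  exact h.eq_of_label_eq (r := 16 * k) (by omega)
    (mem_ballSet_trans (mem_ballSet_comm.1 hp) hq (by omega)) (Fin.ext hmod)

/-- Labels are below `m`, so the key orders lexicographically, shifted distance first. -/
theorem _root_.QualitativeGraphs.Owns.add_le {σ : V → Option ℕ} {x p q : V} {u v : ℕ}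
    (hp : Owns G k φ σ x p) (hu : σ p = some u) (hq : q ∈ ballSet G x (8 * k))
    (hv : σ q = some v) : G.dist x p + u ≤ G.dist x q + v := by
  obtain ⟨_, u', hu', hmin⟩ := hp
  obtain rfl : u' = u := Option.some.inj (hu'.symm.trans hu)
  have h1 := hmin q v hq hv
  by_contra hlt
  have h2 : (G.dist x q + v + 1) * m ≤ (G.dist x p + u') * m :=
    Nat.mul_le_mul_right _ (not_le.1 hlt)
  have h3 := (φ q).isLt
  rw [add_mul, one_mul] at h2
  omega

/-- Some center lies within `4 * k` and has shift below `k`. The gap between `5 * k` and `8 * k`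
leaves room to pass to a neighbouring vertex. -/
theorem owns_add_lt (h : CellSetting G d D k A φ) {ω : Fin m → Fin k.factorial} {x p : V} {u : ℕ}
    (hp : Owns G k φ (shift G k A φ ω) x p) (hu : shift G k A φ ω p = some u) :
    G.dist x p + u < 5 * k := by
  obtain ⟨q, hq, hn⟩ := exists_center (G := G) (A := A) (φ := φ) ω x
  obtain ⟨v, hv⟩ := Option.ne_none_iff_exists'.1 hn
  have h1 := hp.add_le hu (ballSet_mono (by omega) hq) hv
  have h2 := dist_le_of_mem_ballSet hq
  have h3 : v < k := (h.shift_mem_goodShifts hv).1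
  omega

/-- The cell of a center contains the ball of radius `k` around it. -/
theorem owns_of_mem_ballSet (h : CellSetting G d D k A φ) {ω : Fin m → Fin k.factorial} {x p : V}
    (hp : shift G k A φ ω p ≠ none) (hx : x ∈ ballSet G p k) :
    Owns G k φ (shift G k A φ ω) x p := by
  obtain ⟨q, hq⟩ := exists_owns (G := G) (A := A) (φ := φ) ω x
  have hpx := mem_ballSet_comm.1 hx
  obtain ⟨u, hu⟩ := Option.ne_none_iff_exists'.1 hp
  obtain ⟨v, hv, _⟩ := hq.2
  have h1 := hq.add_le hv (ballSet_mono (by omega) hpx) hu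
  have h2 := dist_le_of_mem_ballSet hpx
  have h3 : u < k := (h.shift_mem_goodShifts hu).1
  -- The owner `q` satisfies `d(x, q) + v ≤ d(x, p) + u < 2 * k`, so `p` and `q` are less than `3 *
  -- k` apart.
  have hqp : p = q := h.center_separated ω p hp q (by simp [hv])
    (mem_ballSet_trans hx (mem_ballSet_dist hq.1) (by omega))
  rwa [hqp]

/-- A vertex of the cell of `p` adjacent to another cell is in conflict for some center. -/
theorem exists_conflict (h : CellSetting G d D k A φ) {ω : Fin m → Fin k.factorial} {x y p q : V}
    (hp : Owns G k φ (shift G k A φ ω) x p) (hq : Owns G k φ (shift G k A φ ω) y q)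
    (hpq : p ≠ q) (hxy : G.Adj x y) :
    ∃ c u, shift G k A φ ω c = some u ∧ c ∈ ballSet G x (8 * k) ∧
      x ∈ conflict G k (earlierShift G k A φ ω c) c u := by
  have hk := h.k_pos
  obtain ⟨u, hu, _⟩ := hp.2
  obtain ⟨v, hv, _⟩ := hq.2
  have hxy1 := mem_ballSet_one_of_adj hxy
  have hyx1 := mem_ballSet_comm.1 hxy1
  have hd1 := dist_le_of_mem_ballSet hxy1
  have hd2 := dist_le_of_mem_ballSet hyx1
  have h1 := h.owns_add_lt hp hu
  have h2 := h.owns_add_lt hq hv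
  have hqx : q ∈ ballSet G x (8 * k) :=
    mem_ballSet_trans hxy1 (mem_ballSet_dist hq.1) (by omega)
  have hpy : p ∈ ballSet G y (8 * k) :=
    mem_ballSet_trans hyx1 (mem_ballSet_dist hp.1) (by omega)
  have h3 := hp.add_le hu hqx hv
  have h4 := hq.add_le hv hpy hu
  have h5 := dist_triangle_of_mem_ballSet hxy1 hq.1
  have h6 := dist_triangle_of_mem_ballSet hyx1 hp.1
  -- Crossing the edge changes each distance by at most 1, which gives the tie within 2. The center
  -- with the larger label is charged, because its shift is chosen with the other one already known.
  rcases lt_trichotomy (φ p) (φ q) with hlt | heq | hlt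
  · refine ⟨q, v, hv, hqx, mem_ballSet_comm.1 hqx, p, u,
      earlierShift_eq_some.2 ⟨hlt, hu⟩, hp.1, ?_⟩
    rw [SimpleGraph.dist_comm (u := q)]
    omega
  · exact absurd (h.eq_of_label_eq (r := 16 * k) (by omega)
      (mem_ballSet_trans (mem_ballSet_comm.1 hp.1) hqx (by omega)) heq) hpq
  · refine ⟨p, u, hu, hp.1, mem_ballSet_comm.1 hp.1, q, v,
      earlierShift_eq_some.2 ⟨hlt, hv⟩, hqx, ?_⟩
    rw [SimpleGraph.dist_comm (u := p)]
    omega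

theorem cellLabel_eq_singleton (h : CellSetting G d D k A φ) {ω : Fin m → Fin k.factorial}
    {x p : V} (hp : Owns G k φ (shift G k A φ ω) x p) : cellLabel G k A φ ω x = {φ p} := by
  ext c
  constructor
  · rintro ⟨q, rfl, hq⟩
    rw [h.owns_unique hp hq]
    rfl
  · rintro rfl
    exact ⟨p, rfl, hp⟩

/-- This is where `64 * k` is needed: the two owners are at distance at most `8 * k + 48 * k + 8 *
k`, so equal labels force them to coincide. -/
theorem owner_eq (h : CellSetting G d D k A φ) {ω : Fin m → Fin k.factorial} {x y p q : V}
    (hp : Owns G k φ (shift G k A φ ω) x p) (hq : Owns G k φ (shift G k A φ ω) y q)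
    (hxy : y ∈ ballSet G x (48 * k)) (hl : cellLabel G k A φ ω x = cellLabel G k A φ ω y) :
    p = q := by
  rw [h.cellLabel_eq_singleton hp, h.cellLabel_eq_singleton hq] at hl
  refine h.eq_of_label_eq (r := 64 * k) le_rfl ?_ (Set.singleton_injective hl)
  refine mem_ballSet_trans (mem_ballSet_trans (mem_ballSet_comm.1 hp.1) hxy le_rfl) hq.1 ?_
  omega

theorem partOf_eq (h : CellSetting G d D k A φ) {ω : Fin m → Fin k.factorial} {x p : V}
    (hp : Owns G k φ (shift G k A φ ω) x p) :
    partOf G (16 * k) (cellLabel G k A φ ω) x = {z | Owns G k φ (shift G k A φ ω) z p} := by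
  ext z
  constructor
  · rintro ⟨hz, hl⟩
    obtain ⟨q, hq⟩ := exists_owns (G := G) (A := A) (φ := φ) ω z
    have := h.owner_eq hp hq (ballSet_mono (by omega) hz) hl
    rw [this]
    exact hq
  · intro hz
    refine ⟨mem_ballSet_trans hp.1 (mem_ballSet_comm.1 hz.1) (by omega), ?_⟩
    rw [h.cellLabel_eq_singleton hp, h.cellLabel_eq_singleton hz]

theorem cellLabel_dichotomy (h : CellSetting G d D k A φ) (ω : Fin m → Fin k.factorial) {x y : V}
    (hl : cellLabel G k A φ ω x = cellLabel G k A φ ω y) :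
    G.edist x y ≤ (16 * k : ℕ) ∨ 3 * ((16 * k : ℕ) : ℕ∞) ≤ G.edist x y := by
  by_cases hd : 3 * ((16 * k : ℕ) : ℕ∞) ≤ G.edist x y
  · exact Or.inr hd
  · left
    obtain ⟨p, hp⟩ := exists_owns (G := G) (A := A) (φ := φ) ω x
    obtain ⟨q, hq⟩ := exists_owns (G := G) (A := A) (φ := φ) ω y
    have hxy : y ∈ ballSet G x (48 * k) := by
      refine (not_le.1 hd).le.trans ?_
      exact_mod_cast (by omega : 3 * (16 * k) ≤ 48 * k)
    obtain rfl := h.owner_eq hp hq hxy hl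
    exact mem_ballSet_trans hp.1 (mem_ballSet_comm.1 hq.1) (by omega)

theorem exists_conflict_of_mem_boundary (h : CellSetting G d D k A φ)
    {ω : Fin m → Fin k.factorial} {x p : V}
    (hx : x ∈ boundary G {z | Owns G k φ (shift G k A φ ω) z p}) :
    ∃ c u, shift G k A φ ω c = some u ∧ c ∈ ballSet G x (8 * k) ∧
      x ∈ conflict G k (earlierShift G k A φ ω c) c u := by
  obtain ⟨hp, y, hy, hxy⟩ := hx
  obtain ⟨q, hq⟩ := exists_owns (G := G) (A := A) (φ := φ) ω y
  refine h.exists_conflict hp hq (fun hpq => hy ?_) hxy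
  rw [hpq]
  exact hq

/-- The cells have small boundary. -/
theorem mul_ncard_boundary_le (h : CellSetting G d D k A φ) (ω : Fin m → Fin k.factorial)
    (x : V) : A * (boundary G (partOf G (16 * k) (cellLabel G k A φ ω) x)).ncard ≤
      D ^ 12 * (partOf G (16 * k) (cellLabel G k A φ ω) x).ncard := by
  obtain ⟨p, hp⟩ := exists_owns (G := G) (A := A) (φ := φ) ω x
  rw [h.partOf_eq hp]
  set cell : Set V := {z | Owns G k φ (shift G k A φ ω) z p} with hcell
  have hpc : shift G k A φ ω p ≠ none := by
    obtain ⟨u, hu, _⟩ := hp.2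
    simp [hu]
  have hcellfin : cell.Finite :=
    (finite_ballSet h.deg p (8 * k)).subset fun z hz => mem_ballSet_comm.1 hz.1
  have hcore : (ballSet G p k).ncard ≤ cell.ncard :=
    Set.ncard_le_ncard (fun z hz => h.owns_of_mem_ballSet hpc hz) hcellfin
  have hcfin : ({q | shift G k A φ ω q ≠ none} ∩ ballSet G p (16 * k)).Finite :=
    (finite_ballSet h.deg p _).inter_of_right _
  let conf : V → Set V := fun c =>
    conflict G k (earlierShift G k A φ ω c) c ((shift G k A φ ω c).getD 0)
  have hconffin : ∀ c, (conf c).Finite := fun c =>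
    (finite_ballSet h.deg c (8 * k)).subset fun z hz => hz.1
  have hsub : boundary G cell ⊆ ⋃ c ∈ hcfin.toFinset, conf c := by
    intro z hz
    obtain ⟨c, u, hu, hc, hzc⟩ := h.exists_conflict_of_mem_boundary hz
    simp only [Set.mem_iUnion, Set.Finite.mem_toFinset]
    refine ⟨c, ⟨by simp [hu], ?_⟩, ?_⟩
    · exact mem_ballSet_trans (mem_ballSet_comm.1 hz.1.1) hc (by omega)
    · simpa only [conf, hu, Option.getD_some] using hzc
  -- The ball of radius `8 * k` at `c` lies within `24 * k ≤ 2 ^ 5 * k` of `p`.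
  have hconf : ∀ c ∈ hcfin.toFinset, A * (conf c).ncard ≤ D ^ 5 * (ballSet G p k).ncard := by
    intro c hc
    rw [Set.Finite.mem_toFinset] at hc
    obtain ⟨u, hu⟩ := Option.ne_none_iff_exists'.1 hc.1
    have h1 := (h.shift_mem_goodShifts hu).2
    simp only [conf, hu, Option.getD_some]
    refine h1.trans (le_trans (Set.ncard_le_ncard ?_ (finite_ballSet h.deg p (2 ^ 5 * k)))
      (ncard_ballSet_le_pow h.doubling h.k_pos p 5))
    exact fun z hz => mem_ballSet_trans hc.2 hz (by omega)
  have hD : D ^ 6 * D ^ 5 ≤ D ^ 12 := by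
    rw [← pow_add]
    exact Nat.pow_le_pow_right h.D_pos (by norm_num)
  calc A * (boundary G cell).ncard
      ≤ A * ∑ c ∈ hcfin.toFinset, (conf c).ncard := by
        refine Nat.mul_le_mul_left _ ((Set.ncard_le_ncard hsub ?_).trans
          (Finset.set_ncard_biUnion_le _ _))
        exact Set.Finite.biUnion (Finset.finite_toSet _) fun c _ => hconffin c
    _ = ∑ c ∈ hcfin.toFinset, A * (conf c).ncard := Finset.mul_sum _ _ _
    _ ≤ hcfin.toFinset.card • (D ^ 5 * (ballSet G p k).ncard) :=
        Finset.sum_le_card_nsmul _ _ _ hconf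
    _ ≤ D ^ 6 * (D ^ 5 * cell.ncard) := by
        rw [smul_eq_mul, ← Set.ncard_eq_toFinset_card _ hcfin]
        exact Nat.mul_le_mul (h.ncard_centers_le ω p) (Nat.mul_le_mul_left _ hcore)
    _ ≤ D ^ 12 * cell.ncard := by
        rw [← mul_assoc]
        exact Nat.mul_le_mul_right _ hD

/-- For a fixed center, a given vertex is in conflict for few seeds. -/
theorem ncard_conflict_seeds_le (h : CellSetting G d D k A φ) (x c : V) :
    {ω : Fin m → Fin k.factorial | ∃ u, shift G k A φ ω c = some u ∧
      x ∈ conflict G k (earlierShift G k A φ ω c) c u}.ncard * k ≤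
      10 * D ^ 6 * Fintype.card (Fin m → Fin k.factorial) := by
  -- All seeds except that of the label of `c` are frozen; the earlier shifts, and with them the
  -- good and the conflicting shifts, are then constant.
  refine card_le_of_update (fun ω : Fin m → Fin k.factorial => ∃ u, shift G k A φ ω c = some u ∧
    x ∈ conflict G k (earlierShift G k A φ ω c) c u) (φ c) k _ ?_ fun ω => ?_
  · rw [Fintype.card_fin]
    exact k.factorial_pos
  set τ := earlierShift G k A φ ω c with hτ
  obtain ⟨hBfin, hB⟩ := ncard_conflict_shifts_le h.deg c x (h.ncard_earlier_le ω c x)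
  have hhalf := h.le_ncard_goodShifts ω c
  rw [← hτ] at hBfin hB hhalf
  have hk := h.k_pos
  have hcount := card_pick_mem_le (k := k) (goodShifts_finite (G := G) (k := k) (A := A) τ c)
    hBfin (by omega) (ncard_goodShifts_le τ c)
  have hsub : {i | ∃ u, shift G k A φ (Function.update ω (φ c) i) c = some u ∧
      x ∈ conflict G k (earlierShift G k A φ (Function.update ω (φ c) i) c) c u} ⊆
      {i : Fin k.factorial | pick i (goodShifts G k A τ c) ∈ {t | x ∈ conflict G k τ c t}} := by
    rintro i ⟨u, hu, hx⟩
    have hpick := shift_eq_some hu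
    rw [earlierShift_update, ← hτ] at hpick hx
    rw [Function.update_self] at hpick
    rw [hpick] at hx
    exact hx
  rw [Fintype.card_fin]
  calc _ ≤ {i : Fin k.factorial | pick i (goodShifts G k A τ c) ∈
          {t | x ∈ conflict G k τ c t}}.ncard * (2 * (goodShifts G k A τ c).ncard) :=
        Nat.mul_le_mul (Set.ncard_le_ncard hsub (Set.toFinite _)) hhalf
    _ = 2 * ({i : Fin k.factorial | pick i (goodShifts G k A τ c) ∈
          {t | x ∈ conflict G k τ c t}}.ncard * (goodShifts G k A τ c).ncard) := by ring
    _ ≤ 2 * (5 * D ^ 6 * k.factorial) :=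
        Nat.mul_le_mul_left _ (hcount.trans (Nat.mul_le_mul_right _ hB))
    _ = 10 * D ^ 6 * k.factorial := by ring

/-- Each vertex is on the boundary of its cell for few seeds. -/
theorem ncard_boundary_seeds_le (h : CellSetting G d D k A φ) (x : V) :
    {ω : Fin m → Fin k.factorial |
      x ∈ boundary G (partOf G (16 * k) (cellLabel G k A φ ω) x)}.ncard * k ≤
      10 * D ^ 12 * Fintype.card (Fin m → Fin k.factorial) := by
  -- The set of centers is the same for all seeds, so one reference seed indexes the union bound.
  let ω₀ : Fin m → Fin k.factorial := fun _ => ⟨0, k.factorial_pos⟩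
  have hcfin : ({q | shift G k A φ ω₀ q ≠ none} ∩ ballSet G x (16 * k)).Finite :=
    (finite_ballSet h.deg x _).inter_of_right _
  let E : V → Set (Fin m → Fin k.factorial) := fun c => {ω | ∃ u, shift G k A φ ω c = some u ∧
      x ∈ conflict G k (earlierShift G k A φ ω c) c u}
  have hsub : {ω : Fin m → Fin k.factorial |
      x ∈ boundary G (partOf G (16 * k) (cellLabel G k A φ ω) x)} ⊆
      ⋃ c ∈ hcfin.toFinset, E c := by
    intro ω hω
    obtain ⟨p, hp⟩ := exists_owns (G := G) (A := A) (φ := φ) ω x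
    rw [Set.mem_ofPred_eq, h.partOf_eq hp] at hω
    obtain ⟨c, u, hu, hc, hxc⟩ := h.exists_conflict_of_mem_boundary hω
    simp only [Set.mem_iUnion, Set.Finite.mem_toFinset]
    refine ⟨c, ⟨?_, ballSet_mono (by omega) hc⟩, u, hu, hxc⟩
    rw [Set.mem_ofPred_eq, Ne, shift_eq_none_congr ω₀ ω]
    simp [hu]
  calc _ ≤ (∑ c ∈ hcfin.toFinset, (E c).ncard) * k :=
        Nat.mul_le_mul_right _ ((Set.ncard_le_ncard hsub (Set.toFinite _)).trans
          (Finset.set_ncard_biUnion_le _ _))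
    _ = ∑ c ∈ hcfin.toFinset, (E c).ncard * k := Finset.sum_mul _ _ _
    _ ≤ hcfin.toFinset.card • (10 * D ^ 6 * Fintype.card (Fin m → Fin k.factorial)) :=
        Finset.sum_le_card_nsmul _ _ _ fun c _ => h.ncard_conflict_seeds_le x c
    _ ≤ D ^ 6 * (10 * D ^ 6 * Fintype.card (Fin m → Fin k.factorial)) := by
        rw [smul_eq_mul, ← Set.ncard_eq_toFinset_card _ hcfin]
        exact Nat.mul_le_mul_right _ (h.ncard_centers_le ω₀ x)
    _ = 10 * D ^ 12 * Fintype.card (Fin m → Fin k.factorial) := by ring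

end CellSetting

theorem isLarge_fin (d s : ℕ) : IsLarge s d (Fin ((d + 1) ^ s)) := by
  intro B
  have h1 : ballSet B.graph B.root s = Set.univ := Set.eq_univ_of_forall B.radius
  have h2 := encard_ballSet_le B.degreeBound B.root s
  rw [h1, Set.encard_univ] at h2
  simpa using h2

end QualitativeGraphs

/-! ### Choice of parameters and conclusion -/

open QualitativeGraphs

theorem mainTheorem1 (d : ℕ) (D : ℝ) (hD : 1 < D) :
    QualitativeGraphs.DistributedStronglyAlmostFinite
      {G : QualitativeGraphs.Gr d | QualitativeGraphs.IsDoubling D G.graph} := by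
  intro ε hε
  obtain ⟨D', hD'⟩ := exists_nat_ge D
  have hDpos : 1 ≤ D' := by
    have : (1 : ℝ) ≤ D' := hD.le.trans hD'
    exact_mod_cast this
  -- The isoperimetric bound is `D' ^ 12 / A`.
  obtain ⟨A, hA⟩ := exists_nat_ge ((D' : ℝ) ^ 12 / ε)
  have hApos : (0 : ℝ) < A := lt_of_lt_of_le (by positivity) hA
  have hA1 : 1 ≤ A := by exact_mod_cast hApos
  rw [div_le_iff₀ hε] at hA
  -- This makes the boundary probability `10 * D' ^ 12 / k` equal to `1 / A`, which is at most `ε`.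
  set k := 10 * D' ^ 12 * A with hk
  have hkle : 10 * D' ^ 6 * A ≤ k :=
    Nat.mul_le_mul_right _ (Nat.mul_le_mul_left _ (Nat.pow_le_pow_right hDpos (by norm_num)))
  have hk1 : 1 ≤ k := Nat.mul_pos (Nat.mul_pos (by norm_num) (pow_pos hDpos 12)) hA1
  set s := 64 * k with hs
  set m := (d + 1) ^ s with hm
  -- The first summand is the radius required by locality; adding `s` only secures `s ≤ n`.
  set n := (2 * m + 1) * (8 * k) + s with hn
  have hset : ∀ G ∈ {G : Gr d | IsDoubling D G.graph}, ∀ φ : G.V → Fin m,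
      Separating G.graph s φ → CellSetting G.graph d D' k A φ := by
    intro G hG φ hφ
    refine ⟨G.degreeBound, fun x r hr => ?_, hφ, hDpos, hA1, hkle⟩
    have h1 := (hG.2 x r hr).trans (mul_le_mul_of_nonneg_right hD' (Nat.cast_nonneg _))
    exact_mod_cast h1
  set N := Fintype.card (Fin m → Fin k.factorial) with hN
  have hNpos : 0 < N := by
    rw [hN, Fintype.card_fun, Fintype.card_fin]
    exact pow_pos k.factorial_pos _
  let e : Fin N ≃ (Fin m → Fin k.factorial) := (Fintype.equivFin _).symm
  refine ⟨s, n, N, 16 * k, by omega, by omega, hNpos, by omega, Fin m, Set (Fin m),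
    inferInstance, inferInstance, isLarge_fin d s, fun i => cellOracle d n s m k A (e i), ?_, ?_⟩
  · intro i G hG φ hφ
    have h := hset G hG φ hφ
    have halg : algorithm (cellOracle d n s m k A (e i)) G hφ = cellLabel G.graph k A φ (e i) :=
      funext fun x => algorithm_cellOracle (e i) G hφ (Nat.le_add_right _ _) x
    rw [halg]
    refine ⟨fun x y hl => h.cellLabel_dichotomy (e i) hl, fun x => ?_⟩
    refine div_le_of_le_mul₀ (Nat.cast_nonneg _) hε.le ?_
    have h1 := h.mul_ncard_boundary_le (e i) x
    set bd := (boundary G.graph (partOf G.graph (16 * k) (cellLabel G.graph k A φ (e i)) x)).ncard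
    set cl := (partOf G.graph (16 * k) (cellLabel G.graph k A φ (e i)) x).ncard
    have h2 : (A : ℝ) * bd ≤ (D' : ℝ) ^ 12 * cl := by exact_mod_cast h1
    have h3 : (D' : ℝ) ^ 12 * cl ≤ A * ε * cl :=
      mul_le_mul_of_nonneg_right hA (Nat.cast_nonneg _)
    refine le_of_mul_le_mul_left ?_ hApos
    calc (A : ℝ) * bd ≤ A * ε * cl := h2.trans h3
      _ = A * (ε * cl) := by ring
  · intro G hG φ hφ x
    have h := hset G hG φ hφ
    have halg : ∀ i, algorithm (cellOracle d n s m k A (e i)) G hφ =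
        cellLabel G.graph k A φ (e i) := fun i =>
      funext fun x => algorithm_cellOracle (e i) G hφ (Nat.le_add_right _ _) x
    simp only [halg]
    have hcard : {i : Fin N | x ∈ boundary G.graph
          (partOf G.graph (16 * k) (cellLabel G.graph k A φ (e i)) x)}.ncard =
        {ω : Fin m → Fin k.factorial | x ∈ boundary G.graph
          (partOf G.graph (16 * k) (cellLabel G.graph k A φ ω) x)}.ncard := by
      rw [← Set.ncard_image_of_injective _ e.injective]
      congr 1
      ext ω
      constructor
      · rintro ⟨i, hi, rfl⟩
        exact hi
      · intro hω
        exact ⟨e.symm ω, by simpa using hω, e.apply_symm_apply ω⟩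
    rw [hcard]
    have h1 := h.ncard_boundary_seeds_le x
    rw [← hN] at h1
    set bs := {ω : Fin m → Fin k.factorial | x ∈ boundary G.graph
          (partOf G.graph (16 * k) (cellLabel G.graph k A φ ω) x)}.ncard
    have h2 : bs * A ≤ N := by
      have hpos : 0 < 10 * D' ^ 12 := Nat.mul_pos (by norm_num) (pow_pos hDpos 12)
      refine Nat.le_of_mul_le_mul_left ?_ hpos
      calc 10 * D' ^ 12 * (bs * A) = bs * k := by rw [hk]; ring
        _ ≤ 10 * D' ^ 12 * N := h1
    have h3 : (bs : ℝ) * A ≤ N := by exact_mod_cast h2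
    have hAε : 1 ≤ A * ε := le_trans (one_le_pow₀ (by exact_mod_cast hDpos)) hA
    rw [div_le_iff₀ (by exact_mod_cast hNpos)]
    calc (bs : ℝ) ≤ bs * (A * ε) := le_mul_of_one_le_right (Nat.cast_nonneg _) hAε
      _ = ε * (bs * A) := by ring
      _ ≤ ε * N := mul_le_mul_of_nonneg_left h3 hε.le
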